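/- Let $(a(m))_{m\ge 0}$ be the Stern sequence, defined by $a(0)=0$, $a(1)=1$, $a(2m)=a(m)$ and $a(2m+1)=a(m)+a(m+1)$, and let $s(m)=a(m+1)$ for $m\ge 0$. A record-setter of $s$ is an integer $v\ge 0$ such that $s(i)<s(v)$ for all $0\le i<v$; it is identified with its base-2 representation, written without leading zeros and with the most significant digit first. For a string $x$ and an integer $j\ge 0$, let $x^j$ denote the concatenation of $j$ copies of $x$. Theorem. Let $n\ge 5$. The record-setters of $s$ whose base-2 representation has length $2n+3$ are exactly those with the following base-2 representations: $$\begin{cases} 1000\,(10)^{n-1}\,0,\\ 100\,100\,(10)^{n-3}\,0\,10,\\ 100\,100\,(10)^{n-2}\,0,\\ 100\,(10)^{i}\,0\,(10)^{n-i-1}\,0, & \text{for } 1<i\le \left\lceil \frac{n-1}{2}\right\rceil,\\ (10)^{i+1}\,0\,(10)^{n-i}, & \text{for } 0\le i\le n. \end{cases}$$ -/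

import Mathlib

/-- The Stern sequence: `a(0) = 0`, `a(1) = 1`, `a(2m) = a(m)`, `a(2m+1) = a(m) + a(m+1)`. -/
def stern : ℕ → ℕ
  | 0 => 0
  | 1 => 1
  | n + 2 =>
    if n % 2 = 0 then stern (n / 2 + 1)
    else stern (n / 2 + 1) + stern (n / 2 + 2)
decreasing_by all_goals omega

theorem stern_zero : stern 0 = 0 := by rw [stern]

theorem stern_one : stern 1 = 1 := by rw [stern]

theorem stern_two_mul (m : ℕ) : stern (2 * m) = stern m := by
  cases m with
  | zero => rfl
  | succ k =>
    rw [show 2 * (k + 1) = 2 * k + 2 by ring, stern, if_pos (by omega)]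
    congr 1
    omega

theorem stern_two_mul_add_one (m : ℕ) : stern (2 * m + 1) = stern m + stern (m + 1) := by
  cases m with
  | zero => simp [stern_zero, stern_one]
  | succ k =>
    rw [show 2 * (k + 1) + 1 = (2 * k + 1) + 2 by ring, stern, if_neg (by omega)]
    congr 2 <;> omega

/-- The shifted Stern sequence `s(n) = a(n+1)`. -/
def sternShift (n : ℕ) : ℕ := stern (n + 1)

/-- `v` is a record-setter of the sequence `f`: `f i < f v` for all `i < v`. -/
def IsRecordSetter (f : ℕ → ℕ) (v : ℕ) : Prop := ∀ i < v, f i < f v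

/-- The base-2 representation of `v`, without leading zeros, most significant digit first. -/
def binaryString (v : ℕ) : List ℕ := (Nat.digits 2 v).reverse

/-- The repetition `x ^ i = x x ⋯ x` (`i` copies) of a string `x`. -/
def strPow (x : List ℕ) (i : ℕ) : List ℕ := (List.replicate i x).flatten

/-!
Write `a = stern` and `s = sternShift`, and read the binary digits of a number from the left: a
digit `0` turns the pair `(a, s)` into `(a, a + s)`, and a digit `1` turns it into `(a + s, s)`.
Growth is fastest when the digits alternate, so among the extensions of an even `x` by `l` digits
the largest value of `s` is the one at `x 1010…`, namely `F(l) a(x) + F(l+1) s(x)`. A number of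
odd length cannot alternate throughout, and its extra digits `0` cost less or more according to
their position.

The record-setters of length `2n+3` increase from `1000 (10)^(n-1) 0` through the two words that
begin with `100100` to the words `100 (10)^i 0 (10)^(n-i-1) 0`, where the position of the inner
`0` improves until it reaches the middle, and then to the words `(10)^(i+1) 0 (10)^(n-i)`. If `v`
lies strictly between two neighbours `r < r'` of this list, consider the first digit where `v` and
`r'` differ. There `r'` has the `1` of a block `10` and `v` has a `0`, so the prefix of `v` up to
this digit bounds `s(v)` by an explicit Fibonacci expression, which is at most `s(r)`.
-/

theorem sternShift_zero : sternShift 0 = 1 := stern_one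

theorem sternShift_two_mul (x : ℕ) : sternShift (2 * x) = stern x + sternShift x :=
  stern_two_mul_add_one x

theorem sternShift_two_mul_add_one (x : ℕ) : sternShift (2 * x + 1) = sternShift x :=
  stern_two_mul (x + 1)

theorem stern_four : stern 4 = 1 := by
  rw [show 4 = 2 * (2 * 1) by norm_num, stern_two_mul, stern_two_mul, stern_one]

theorem sternShift_four : sternShift 4 = 3 := by
  rw [show 4 = 2 * (2 * (2 * 0 + 1)) by norm_num]
  simp only [sternShift_two_mul, sternShift_two_mul_add_one, stern_two_mul, sternShift_zero]
  norm_num [stern_one]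

theorem stern_two_mul_le_sternShift_two_mul (x : ℕ) : stern (2 * x) ≤ sternShift (2 * x) := by
  rw [stern_two_mul, sternShift_two_mul]
  exact Nat.le_add_right _ _

/-- The value of `sternShift` at the word `x (10)^(l/2)` for even `l` and `x (10)^((l-1)/2) 0` for
odd `l`. For even `x` it is the maximum over all extensions of the word `x` by `l` digits. -/
def altValue (l x : ℕ) : ℕ := Nat.fib l * stern x + Nat.fib (l + 1) * sternShift x

theorem altValue_zero_left (x : ℕ) : altValue 0 x = sternShift x := by
  simp [altValue]

theorem altValue_one_left (x : ℕ) : altValue 1 x = stern x + sternShift x := by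
  simp [altValue]

theorem altValue_add_two (l x : ℕ) : altValue (l + 2) x = altValue (l + 1) x + altValue l x := by
  simp only [altValue, Nat.fib_add_two]
  ring

theorem altValue_zero_right (l : ℕ) : altValue l 0 = Nat.fib (l + 1) := by
  simp [altValue, stern_zero, sternShift_zero]

theorem altValue_two_mul (l x : ℕ) :
    altValue l (2 * x) = Nat.fib (l + 2) * stern x + Nat.fib (l + 1) * sternShift x := by
  rw [altValue, stern_two_mul, sternShift_two_mul, Nat.fib_add_two]
  ring

theorem altValue_one_eq_sternShift_two_mul (x : ℕ) : altValue 1 x = sternShift (2 * x) := by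
  rw [altValue_one_left, sternShift_two_mul]

theorem altValue_le_succ (l x : ℕ) : altValue l x ≤ altValue (l + 1) x := by
  cases l with
  | zero => simp [altValue]
  | succ l => rw [altValue_add_two]; exact Nat.le_add_right _ _

/-- The third bound makes the induction go through: it is the next maximum. -/
theorem stern_sternShift_le_altValue {v l x : ℕ} (h : v / 2 ^ l = 2 * x) :
    stern v ≤ altValue l (2 * x) ∧ sternShift v ≤ altValue l (2 * x) ∧
      stern v + sternShift v ≤ altValue (l + 1) (2 * x) := by
  induction l generalizing v with
  | zero =>
    rw [pow_zero, Nat.div_one] at h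
    subst h
    rw [altValue_zero_left, zero_add, altValue_one_left]
    exact ⟨stern_two_mul_le_sternShift_two_mul x, le_rfl, le_rfl⟩
  | succ l ih =>
    rw [pow_succ', ← Nat.div_div_eq_div_mul] at h
    obtain ⟨h_stern, h_shift, h_sum⟩ := ih h
    have h_mono := altValue_le_succ l (2 * x)
    rw [altValue_add_two]
    rcases Nat.even_or_odd' v with ⟨u, rfl | rfl⟩
    · rw [Nat.mul_div_cancel_left u two_pos] at h_stern h_shift h_sum
      rw [stern_two_mul, sternShift_two_mul]
      omega
    · rw [show (2 * u + 1) / 2 = u by omega] at h_stern h_shift h_sum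
      rw [stern_two_mul_add_one, ← sternShift, sternShift_two_mul_add_one]
      omega

theorem sternShift_le_altValue {v l x : ℕ} (h : v / 2 ^ l = 2 * x) :
    sternShift v ≤ altValue l (2 * x) :=
  (stern_sternShift_le_altValue h).2.1

theorem sternShift_le_fib {v l : ℕ} (h : v < 2 ^ l) : sternShift v ≤ Nat.fib (l + 1) := by
  rw [← altValue_zero_right]
  exact sternShift_le_altValue (x := 0) (Nat.div_eq_of_lt h)

/-- The number whose binary representation is `x (10)^j`. -/
def appendTens (x : ℕ) : ℕ → ℕ
  | 0 => x
  | j + 1 => 4 * appendTens x j + 2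

theorem appendTens_zero (x : ℕ) : appendTens x 0 = x := rfl

theorem appendTens_succ (x j : ℕ) : appendTens x (j + 1) = 4 * appendTens x j + 2 := rfl

theorem appendTens_add (x i j : ℕ) : appendTens x (i + j) = appendTens (appendTens x i) j := by
  induction j with
  | zero => rfl
  | succ j ih => rw [← add_assoc, appendTens_succ, ih, appendTens_succ]

theorem mul_four_pow_le_appendTens (x j : ℕ) : x * 4 ^ j ≤ appendTens x j := by
  induction j with
  | zero => simp [appendTens]
  | succ j ih => rw [appendTens_succ, pow_succ, ← mul_assoc]; omega

theorem appendTens_lt_mul_four_pow (x j : ℕ) : appendTens x j < (x + 1) * 4 ^ j := by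
  induction j with
  | zero => simp [appendTens]
  | succ j ih => rw [appendTens_succ, pow_succ, ← mul_assoc]; omega

theorem appendTens_ne_zero {x : ℕ} (hx : x ≠ 0) (j : ℕ) : appendTens x j ≠ 0 := by
  have h_pos : 0 < x * 4 ^ j := by positivity
  exact (h_pos.trans_le (mul_four_pow_le_appendTens x j)).ne'

theorem stern_four_mul_add_two (x : ℕ) : stern (4 * x + 2) = stern x + sternShift x := by
  rw [show 4 * x + 2 = 2 * (2 * x + 1) by ring, stern_two_mul, stern_two_mul_add_one, sternShift]

theorem sternShift_four_mul_add_two (x : ℕ) :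
    sternShift (4 * x + 2) = stern x + 2 * sternShift x := by
  rw [show 4 * x + 2 = 2 * (2 * x + 1) by ring, sternShift_two_mul, stern_two_mul_add_one,
    sternShift_two_mul_add_one, ← sternShift]
  ring

theorem altValue_appendTens (l x j : ℕ) :
    altValue l (appendTens x j) = altValue (l + 2 * j) x := by
  induction j generalizing l with
  | zero => rfl
  | succ j ih =>
    rw [show l + 2 * (j + 1) = l + 2 + 2 * j by ring, ← ih, appendTens_succ]
    simp only [altValue, stern_four_mul_add_two, sternShift_four_mul_add_two, Nat.fib_add_two]
    ring

theorem sternShift_appendTens (x j : ℕ) : sternShift (appendTens x j) = altValue (2 * j) x := by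
  rw [← altValue_zero_left, altValue_appendTens, zero_add]

theorem stern_add_sternShift_appendTens (x j : ℕ) :
    stern (appendTens x j) + sternShift (appendTens x j) = altValue (2 * j + 1) x := by
  rw [← altValue_one_left, altValue_appendTens, add_comm]

theorem exists_div_eq_of_lt_appendTens {v x m : ℕ} (hlo : x * 4 ^ m ≤ v)
    (hhi : v < appendTens x m) :
    ∃ j k, j + k + 1 = m ∧ v / 2 ^ (2 * k + 1) = 2 * appendTens x j := by
  induction m generalizing v with
  | zero => simp only [appendTens_zero, pow_zero, mul_one] at hlo hhi; omega
  | succ m ih =>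
    rw [appendTens_succ] at hhi
    rcases Nat.lt_or_ge (v / 4) (appendTens x m) with h_lt | h_ge
    · have hlo' : x * 4 ^ m ≤ v / 4 := by
        rw [Nat.le_div_iff_mul_le (by norm_num), mul_assoc, ← pow_succ]
        exact hlo
      obtain ⟨j, k, hjk, hv⟩ := ih hlo' h_lt
      refine ⟨j, k + 1, by omega, ?_⟩
      rw [← hv, Nat.div_div_eq_div_mul]
      congr 1
      ring
    · exact ⟨m, 0, by omega, by rw [mul_zero, zero_add, pow_one]; omega⟩

theorem altValue_two_mul_add (l x : ℕ) :
    altValue l (2 * x) + Nat.fib l * sternShift x =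
      altValue (l + 1) x + Nat.fib l * stern x := by
  rw [altValue_two_mul, altValue, Nat.fib_add_two]
  ring

theorem altValue_two_mul_appendTens_add (l x i : ℕ) :
    altValue l (2 * appendTens x i) + Nat.fib l * altValue (2 * i) x =
      Nat.fib (l + 2) * altValue (2 * i + 1) x := by
  rw [altValue_two_mul, ← stern_add_sternShift_appendTens, ← sternShift_appendTens,
    Nat.fib_add_two]
  ring

/-- The effect of moving the extra digit `0` from `x 0 (10)^i` to `x (10)^i 0`. -/
theorem altValue_two_mul_appendTens_add_eq (l x i : ℕ) :
    altValue l (2 * appendTens x i) + Nat.fib (2 * i) * Nat.fib (l + 2) * stern x =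
      altValue (l + 2 * i) (2 * x) + Nat.fib (2 * i) * Nat.fib (l + 1) * sternShift x := by
  have h_appendTens := altValue_two_mul_appendTens_add l x i
  rw [altValue_two_mul (l + 2 * i), Nat.fib_add l (2 * i),
    show l + 2 * i + 2 = l + 1 + 2 * i + 1 by ring, Nat.fib_add (l + 1) (2 * i)]
  simp only [altValue, Nat.fib_add_two] at h_appendTens ⊢
  linarith

theorem altValue_two_mul_lt_iff (l x : ℕ) :
    altValue (l + 2) (2 * x) < altValue l (2 * (4 * x + 2)) ↔
      Nat.fib (l + 2) * stern x < Nat.fib (l + 1) * sternShift x := by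
  have h_move := altValue_two_mul_appendTens_add_eq l x 1
  simp only [mul_one, Nat.fib_two, one_mul, appendTens_succ, appendTens_zero] at h_move
  omega

theorem fib_mul_stern_appendTens_lt_iff (l x j : ℕ) :
    Nat.fib (l + 2 * j + 2) * stern (appendTens x j) <
        Nat.fib (l + 2 * j + 1) * sternShift (appendTens x j) ↔
      Nat.fib (l + 2) * stern x < Nat.fib (l + 1) * sternShift x := by
  induction j with
  | zero => rfl
  | succ j ih =>
    rw [← ih, appendTens_succ, stern_four_mul_add_two, sternShift_four_mul_add_two,
      show l + 2 * (j + 1) = l + 2 * j + 2 by ring]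
    simp only [Nat.fib_add_two]
    constructor <;> intro h <;> linarith

/-- Whether moving the extra `0` of `x (10)^j 0` one block to the right increases the value depends
only on the difference of its distances from the two ends. -/
theorem altValue_two_mul_appendTens_lt_iff (l x j : ℕ) :
    altValue (l + 2 * j + 2) (2 * appendTens x j) <
        altValue (l + 2 * j) (2 * appendTens x (j + 1)) ↔
      Nat.fib (l + 2) * stern x < Nat.fib (l + 1) * sternShift x := by
  rw [appendTens_succ, altValue_two_mul_lt_iff, fib_mul_stern_appendTens_lt_iff]

theorem stern_appendTens_lt_sternShift {x : ℕ} (hx : stern x < sternShift x) (j : ℕ) :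
    stern (appendTens x j) < sternShift (appendTens x j) := by
  induction j with
  | zero => exact hx
  | succ j ih =>
    rw [appendTens_succ, stern_four_mul_add_two, sternShift_four_mul_add_two]
    omega

theorem altValue_even_lt {x : ℕ} (hx : 2 * stern x < sternShift x) (j k : ℕ) :
    altValue (2 * k + 2) (2 * appendTens x j) < altValue (2 * k) (2 * appendTens x (j + 1)) := by
  rcases le_total j k with h | h
  · obtain ⟨d, rfl⟩ := Nat.exists_eq_add_of_le' h
    rw [mul_add, altValue_two_mul_appendTens_lt_iff]
    have h_fib : Nat.fib (2 * d + 2) ≤ Nat.fib (2 * d + 1) * 2 := by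
      rw [Nat.fib_add_two]
      linarith [Nat.fib_le_fib_succ (n := 2 * d)]
    calc Nat.fib (2 * d + 2) * stern x ≤ Nat.fib (2 * d + 1) * (2 * stern x) := by
          rw [← mul_assoc]
          exact Nat.mul_le_mul_right _ h_fib
      _ < Nat.fib (2 * d + 1) * sternShift x :=
          Nat.mul_lt_mul_of_pos_left hx (Nat.fib_pos.2 (Nat.succ_pos _))
  · obtain ⟨d, rfl⟩ := Nat.exists_eq_add_of_le' h
    rw [add_assoc, appendTens_add, appendTens_add]
    have h_iff := altValue_two_mul_appendTens_lt_iff 0 (appendTens x d) k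
    rw [zero_add] at h_iff
    refine h_iff.2 ?_
    simpa using stern_appendTens_lt_sternShift (x := x) (by omega) d

theorem altValue_even_le {x : ℕ} (hx : 2 * stern x < sternShift x) (c j k : ℕ) :
    altValue (2 * (c + k)) (2 * appendTens x j) ≤ altValue (2 * c) (2 * appendTens x (j + k)) := by
  induction k generalizing j with
  | zero => rfl
  | succ k ih =>
    have h_first := (altValue_even_lt hx j (c + k)).le
    have h_rest := ih (j + 1)
    rw [add_right_comm, add_assoc] at h_rest
    exact h_first.trans h_rest

theorem altValue_four_lt {i k : ℕ} (h : i ≤ k) :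
    altValue (2 * k + 3) (2 * appendTens 4 i) <
      altValue (2 * k + 1) (2 * appendTens 4 (i + 1)) := by
  obtain ⟨d, rfl⟩ := Nat.exists_eq_add_of_le' h
  rw [show 2 * (d + i) + 3 = 2 * d + 1 + 2 * i + 2 by ring,
    show 2 * (d + i) + 1 = 2 * d + 1 + 2 * i by ring, altValue_two_mul_appendTens_lt_iff,
    stern_four, sternShift_four, Nat.fib_add_two]
  linarith [Nat.fib_le_fib_succ (n := 2 * d + 1), Nat.fib_pos.2 (Nat.succ_pos (2 * d))]

theorem altValue_four_le {i k : ℕ} (h : k ≤ i) :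
    altValue (2 * k + 1) (2 * appendTens 4 (i + 2)) ≤
      altValue (2 * k + 3) (2 * appendTens 4 (i + 1)) := by
  obtain ⟨d, rfl⟩ := Nat.exists_eq_add_of_le h
  have h_iff := altValue_two_mul_appendTens_lt_iff 1 (appendTens 4 (d + 1)) k
  rw [← appendTens_add, ← appendTens_add] at h_iff
  have h_not : ¬ Nat.fib 3 * stern (appendTens 4 (d + 1)) <
      Nat.fib 2 * sternShift (appendTens 4 (d + 1)) := by
    rw [appendTens_succ, stern_four_mul_add_two, sternShift_four_mul_add_two]
    norm_num [Nat.fib_add_two]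
    omega
  rw [show 2 * k + 1 = 1 + 2 * k by ring, show 2 * k + 3 = 1 + 2 * k + 2 by ring,
    show k + d + 2 = d + 1 + (k + 1) by ring, show k + d + 1 = d + 1 + k by ring]
  exact not_lt.1 (h_iff.not.2 h_not)

theorem fib_add_le_fib_mul_fib (l m : ℕ) :
    Nat.fib (l + m + 1) ≤ Nat.fib (l + 1) * Nat.fib (m + 2) := by
  rw [Nat.fib_add, Nat.fib_add_two, mul_add]
  exact Nat.add_le_add_right (Nat.mul_le_mul_right _ Nat.fib_le_fib_succ) _

theorem fib_mul_add_stern_appendTens_le {y c : ℕ} (h_stern : 2 * c ≤ stern y)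
    (h_diff : c + stern y ≤ sternShift y) (j : ℕ) :
    Nat.fib (2 * j + 2) * c + stern (appendTens y j) ≤ sternShift (appendTens y j) := by
  cases j with
  | zero => simpa [appendTens] using h_diff
  | succ j =>
    rw [appendTens_succ, stern_four_mul_add_two, sternShift_four_mul_add_two,
      sternShift_appendTens, altValue, show 2 * (j + 1) + 2 = 2 * j + 4 by ring]
    simp only [Nat.fib_add_two]
    have h_even := Nat.mul_le_mul_left (Nat.fib (2 * j)) h_stern
    have h_odd := Nat.mul_le_mul_left (Nat.fib (2 * j + 1)) (show 3 * c ≤ sternShift y by omega)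
    linarith

theorem two_mul_fib_mul_le_stern (x i : ℕ) :
    2 * (Nat.fib (2 * i) * sternShift x) ≤ stern (appendTens x (i + 1)) := by
  rw [appendTens_succ, stern_four_mul_add_two, stern_add_sternShift_appendTens, altValue,
    ← mul_assoc]
  have h_fib : 2 * Nat.fib (2 * i) ≤ Nat.fib (2 * i + 2) := by
    rw [Nat.fib_add_two, two_mul]
    exact Nat.add_le_add_left Nat.fib_le_fib_succ _
  exact (Nat.mul_le_mul_right _ h_fib).trans (Nat.le_add_left _ _)

theorem fib_mul_le_sternShift (x i : ℕ) :
    Nat.fib (2 * i) * sternShift x ≤ sternShift (appendTens x (i + 1)) := by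
  rw [sternShift_appendTens, altValue]
  exact (Nat.mul_le_mul_right _ (Nat.fib_mono (by omega))).trans (Nat.le_add_left _ _)

theorem altValue_two_mul_appendTens_succ_le (l x i : ℕ) :
    altValue (l + 1) (2 * appendTens x (i + 1)) ≤
      altValue (l + 1 + 2 * i) (2 * appendTens x 1) +
        Nat.fib l * (Nat.fib (2 * i) * sternShift x) := by
  have h_move := altValue_two_mul_appendTens_add_eq (l + 1) (appendTens x 1) i
  rw [← appendTens_add, add_comm 1 i, appendTens_succ x 0, appendTens_zero,
    stern_four_mul_add_two, sternShift_four_mul_add_two] at h_move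
  rw [appendTens_succ x 0, appendTens_zero]
  simp only [Nat.fib_add_two] at h_move
  linarith [Nat.zero_le (Nat.fib (2 * i) * Nat.fib (l + 1) * stern x)]

/-- Of two extra digits `0`, the first can be moved to the front and the second omitted: moving the
first one loses at most `F(2i) F(l+2j+1) s(x)`, and omitting the second gains at least as much. -/
theorem altValue_two_gaps_le (l x i j : ℕ) :
    altValue (l + 1) (2 * appendTens (2 * appendTens x (i + 1)) j) ≤
      altValue (l + 2 * (i + j) + 2) (2 * appendTens x 1) := by
  set y := 2 * appendTens x (i + 1) with hy
  set c := Nat.fib (2 * i) * sternShift x with hc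
  have h_stern : 2 * c ≤ stern y := by
    rw [hy, stern_two_mul]
    exact two_mul_fib_mul_le_stern x i
  have h_diff : c + stern y ≤ sternShift y := by
    rw [hy, stern_two_mul, sternShift_two_mul, add_comm]
    exact Nat.add_le_add_left (fib_mul_le_sternShift x i) _
  have h_omit := altValue_two_mul_add (l + 1) (appendTens y j)
  rw [altValue_appendTens, show l + 1 + 1 + 2 * j = l + 2 * j + 1 + 1 by ring] at h_omit
  have h_gain := Nat.mul_le_mul_left (Nat.fib (l + 1))
    (fib_mul_add_stern_appendTens_le h_stern h_diff j)
  have h_fib := Nat.mul_le_mul_right c (fib_add_le_fib_mul_fib l (2 * j))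
  have h_move := altValue_two_mul_appendTens_succ_le (l + 2 * j + 1) x i
  rw [show l + 2 * j + 1 + 1 + 2 * i = l + 2 * (i + j) + 2 by ring, ← hy, ← hc] at h_move
  rw [mul_add, ← mul_assoc] at h_gain
  linarith

/-- The number whose binary representation is `x (10)^i 0 (10)^k`. The record-setters of the theorem
are `gapWord 0 (i+1) k`, `gapWord 36 i 1` and `2 * gapWord 4 i k`. -/
def gapWord (x i k : ℕ) : ℕ := appendTens (2 * appendTens x i) k

theorem altValue_gapWord (l x i k : ℕ) :
    altValue l (gapWord x i k) = altValue (l + 2 * k) (2 * appendTens x i) :=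
  altValue_appendTens _ _ _

theorem sternShift_gapWord (x i k : ℕ) :
    sternShift (gapWord x i k) = altValue (2 * k) (2 * appendTens x i) :=
  sternShift_appendTens _ _

theorem sternShift_two_mul_gapWord (x i k : ℕ) :
    sternShift (2 * gapWord x i k) = altValue (2 * k + 1) (2 * appendTens x i) := by
  rw [← altValue_one_eq_sternShift_two_mul, altValue_gapWord, add_comm]

theorem gapWord_four_zero (k : ℕ) : gapWord 4 0 k = appendTens 8 k := rfl

theorem mul_four_pow_le_gapWord (x i k : ℕ) : 2 * x * 4 ^ (i + k) ≤ gapWord x i k := by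
  refine le_trans ?_ (mul_four_pow_le_appendTens _ k)
  rw [pow_add, ← mul_assoc, mul_assoc 2]
  gcongr
  exact mul_four_pow_le_appendTens x i

theorem sternShift_le_max_altValue_gapWord {t v x i k : ℕ}
    (hlo : gapWord x (i + 1) (k + 1) ≤ v / 2 ^ t) (hhi : v / 2 ^ t < gapWord x (i + 2) k) :
    sternShift v ≤ max (altValue t (gapWord x (i + 1) (k + 1)))
      (altValue t (gapWord x 1 (i + k + 1))) := by
  have h_start : 2 * appendTens x (i + 1) * 4 ^ (k + 1) ≤ v / 2 ^ t :=
    (mul_four_pow_le_appendTens _ _).trans hlo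
  rcases lt_or_ge (v / 2 ^ t) (2 * appendTens x (i + 2) * 4 ^ k) with h_lt | h_ge
  · have h_prefix : v / 2 ^ (t + 2 * (k + 1)) = 2 * appendTens x (i + 1) := by
      rw [pow_add, ← Nat.div_div_eq_div_mul, pow_mul, show (2 : ℕ) ^ 2 = 4 by norm_num]
      apply Nat.div_eq_of_lt_le h_start
      refine h_lt.trans_le ?_
      rw [appendTens_succ x (i + 1), pow_succ]
      linarith [Nat.zero_le (4 ^ k)]
    rw [altValue_gapWord]
    exact le_max_of_le_left (sternShift_le_altValue h_prefix)
  · obtain ⟨j, l, rfl, h_prefix⟩ := exists_div_eq_of_lt_appendTens h_ge hhi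
    rw [Nat.div_div_eq_div_mul, ← pow_add] at h_prefix
    refine le_max_of_le_right ((sternShift_le_altValue h_prefix).trans ?_)
    rw [altValue_gapWord,
      show t + 2 * (i + (j + l + 1) + 1) = t + 2 * l + 2 * (i + 1 + j) + 2 by ring]
    exact altValue_two_gaps_le (t + 2 * l) x (i + 1) j

/-- No `v ≥ r` below `r'` exceeds `f r`, but `r'` does: if `r` is a record-setter of `f`, then `r'`
is the next one. -/
def IsRecordStep (f : ℕ → ℕ) (r r' : ℕ) : Prop :=
  (∀ v, r ≤ v → v < r' → f v ≤ f r) ∧ f r < f r'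

theorem IsRecordStep.isRecordSetter {f : ℕ → ℕ} {r r' : ℕ} (h : IsRecordStep f r r')
    (hr : IsRecordSetter f r) : IsRecordSetter f r' := by
  intro v hv
  rcases lt_or_ge v r with h_lt | h_ge
  · exact (hr v h_lt).trans h.2
  · exact (h.1 v h_ge hv).trans_lt h.2

theorem IsRecordStep.eq_or_le {f : ℕ → ℕ} {r r' v : ℕ} (h : IsRecordStep f r r')
    (hv : IsRecordSetter f v) (hrv : r ≤ v) : v = r ∨ r' ≤ v := by
  by_contra! h_between
  exact (h.1 v hrv h_between.2).not_gt (hv r (hrv.lt_of_ne' h_between.1))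

theorem isRecordSetter_of_forall_isRecordStep {f r : ℕ → ℕ} {N : ℕ}
    (h : ∀ i < N, IsRecordStep f (r i) (r (i + 1))) (hr : IsRecordSetter f (r 0)) :
    ∀ i ≤ N, IsRecordSetter f (r i) := by
  intro i hi
  induction i with
  | zero => exact hr
  | succ i ih => exact (h i hi).isRecordSetter (ih (by omega))

theorem IsRecordSetter.exists_eq_or_le {f r : ℕ → ℕ} {N v : ℕ} (hv : IsRecordSetter f v)
    (h : ∀ i < N, IsRecordStep f (r i) (r (i + 1))) (hrv : r 0 ≤ v) :
    (∃ i < N, v = r i) ∨ r N ≤ v := by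
  induction N with
  | zero => exact Or.inr hrv
  | succ N ih =>
    rcases ih fun i hi => h i (by omega) with ⟨i, hi, h_eq⟩ | h_le
    · exact Or.inl ⟨i, by omega, h_eq⟩
    · exact ((h N N.lt_succ_self).eq_or_le hv h_le).imp_left fun h_eq => ⟨N, N.lt_succ_self, h_eq⟩

theorem isRecordStep_gapWord_zero (i k : ℕ) :
    IsRecordStep sternShift (gapWord 0 (i + 1) (k + 1)) (gapWord 0 (i + 2) k) := by
  have h_zero : 2 * stern 0 < sternShift 0 := by rw [stern_zero, sternShift_zero]; norm_num
  refine ⟨fun v hlo hhi => ?_, ?_⟩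
  · have h_max := sternShift_le_max_altValue_gapWord (t := 0) (v := v) (by simpa using hlo)
      (by simpa using hhi)
    have h_first := altValue_even_le h_zero (k + 1) 1 i
    rw [show k + 1 + i = i + k + 1 by ring, add_comm 1 i, ← sternShift_gapWord,
      ← sternShift_gapWord] at h_first
    rw [altValue_zero_left, altValue_zero_left] at h_max
    rwa [max_eq_left h_first] at h_max
  · rw [sternShift_gapWord, sternShift_gapWord]
    exact altValue_even_lt h_zero (i + 1) k

theorem sternShift_two_mul_gapWord_four_lt {i k : ℕ} (h : i ≤ k) :
    sternShift (2 * gapWord 4 i (k + 1)) < sternShift (2 * gapWord 4 (i + 1) k) := by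
  rw [sternShift_two_mul_gapWord, sternShift_two_mul_gapWord]
  exact altValue_four_lt h

theorem sternShift_two_mul_gapWord_four_le_add {i k d : ℕ} (h : i + d ≤ k + 1) :
    sternShift (2 * gapWord 4 i (k + d)) ≤ sternShift (2 * gapWord 4 (i + d) k) := by
  induction d generalizing k with
  | zero => rfl
  | succ d ih =>
    have h_rest := ih (k := k + 1) (by omega)
    rw [add_right_comm] at h_rest
    exact h_rest.trans (sternShift_two_mul_gapWord_four_lt (by omega)).le

theorem sternShift_two_mul_gapWord_four_add_le {i k d : ℕ} (h : k + d ≤ i) :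
    sternShift (2 * gapWord 4 (i + d) k) ≤ sternShift (2 * gapWord 4 i (k + d)) := by
  induction d generalizing k with
  | zero => rfl
  | succ d ih =>
    have h_rest := ih (k := k + 1) (by omega)
    rw [add_right_comm] at h_rest
    refine le_trans ?_ h_rest
    obtain ⟨p, hp⟩ : ∃ p, i + d = p + 1 := ⟨i + d - 1, by omega⟩
    rw [← add_assoc, hp, sternShift_two_mul_gapWord, sternShift_two_mul_gapWord]
    exact altValue_four_le (by omega)

theorem sternShift_two_mul_gapWord_four_le_of_balanced {i k j l : ℕ} (hik : i ≤ k + 1)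
    (hki : k ≤ i) (h_sum : j + l = i + k) :
    sternShift (2 * gapWord 4 j l) ≤ sternShift (2 * gapWord 4 i k) := by
  rcases le_total j i with h | h
  · obtain ⟨d, rfl⟩ := Nat.exists_eq_add_of_le h
    obtain rfl : l = k + d := by omega
    exact sternShift_two_mul_gapWord_four_le_add hik
  · obtain ⟨d, rfl⟩ := Nat.exists_eq_add_of_le h
    obtain rfl : k = l + d := by omega
    exact sternShift_two_mul_gapWord_four_add_le hki

theorem isRecordStep_gapWord_four {i k : ℕ} (h : i + 1 ≤ k) :
    IsRecordStep sternShift (2 * gapWord 4 (i + 1) (k + 1)) (2 * gapWord 4 (i + 2) k) := by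
  refine ⟨fun v hlo hhi => ?_, sternShift_two_mul_gapWord_four_lt h⟩
  have h_max := sternShift_le_max_altValue_gapWord (t := 1) (v := v) (x := 4) (i := i) (k := k)
    (by omega) (by omega)
  have h_first := sternShift_two_mul_gapWord_four_le_add (i := 1) (k := k + 1) (d := i) (by omega)
  rw [add_comm 1 i, show k + 1 + i = i + k + 1 by ring] at h_first
  rw [altValue_one_eq_sternShift_two_mul, altValue_one_eq_sternShift_two_mul] at h_max
  rwa [max_eq_left h_first] at h_max

theorem sternShift_two_mul_gapWord_four_lt_appendTens (i k : ℕ) :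
    sternShift (2 * gapWord 4 i k) < sternShift (appendTens 4 (i + k + 1)) := by
  have h_lt : stern 4 < sternShift 4 := by rw [stern_four, sternShift_four]; norm_num
  have h_omit := altValue_two_mul_add (2 * k + 1) (appendTens 4 i)
  have h_gain := Nat.mul_lt_mul_of_pos_left (stern_appendTens_lt_sternShift h_lt i)
    (Nat.fib_pos.2 (Nat.succ_pos (2 * k)))
  rw [altValue_appendTens, show 2 * k + 1 + 1 + 2 * i = 2 * (i + k + 1) by ring] at h_omit
  rw [sternShift_two_mul_gapWord, sternShift_appendTens]
  linarith

theorem isRecordStep_gapWord_four_gapWord_zero {i k : ℕ} (hik : i ≤ k + 1) (hki : k ≤ i) :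
    IsRecordStep sternShift (2 * gapWord 4 i k) (gapWord 0 1 (i + k + 1)) := by
  refine ⟨fun v hlo hhi => ?_, sternShift_two_mul_gapWord_four_lt_appendTens i k⟩
  have h_start : 4 * 4 ^ (i + k + 1) ≤ v := by
    have h_gap := mul_four_pow_le_gapWord 4 i k
    rw [pow_succ]
    omega
  obtain ⟨j, l, h_sum, h_prefix⟩ := exists_div_eq_of_lt_appendTens h_start hhi
  have h_le := sternShift_le_altValue h_prefix
  rw [← sternShift_two_mul_gapWord] at h_le
  exact h_le.trans (sternShift_two_mul_gapWord_four_le_of_balanced hik hki (by omega))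

theorem sternShift_gapWord_zero_zero (n : ℕ) :
    sternShift (gapWord 0 n 0) = Nat.fib (2 * n + 2) := by
  rw [gapWord, appendTens_zero, ← altValue_one_eq_sternShift_two_mul, altValue_appendTens,
    altValue_zero_right]
  ring_nf

theorem stern_eight : stern 8 = 1 := by
  rw [show 8 = 2 * 4 by norm_num, stern_two_mul, stern_four]

theorem sternShift_eight : sternShift 8 = 4 := by
  rw [show 8 = 2 * 4 by norm_num, sternShift_two_mul, stern_four, sternShift_four]

theorem stern_thirty_six : stern 36 = 4 := by
  rw [show 36 = 2 * (4 * 4 + 2) by norm_num, stern_two_mul, stern_four_mul_add_two, stern_four,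
    sternShift_four]

theorem sternShift_thirty_six : sternShift 36 = 11 := by
  rw [show 36 = 2 * (4 * 4 + 2) by norm_num, sternShift_two_mul, stern_four_mul_add_two,
    sternShift_four_mul_add_two, stern_four, sternShift_four]

theorem altValue_eight (l : ℕ) : altValue l 8 = Nat.fib l + 4 * Nat.fib (l + 1) := by
  rw [altValue, stern_eight, sternShift_eight]
  ring

theorem altValue_thirty_six (l : ℕ) :
    altValue l 36 = 4 * Nat.fib l + 11 * Nat.fib (l + 1) := by
  rw [altValue, stern_thirty_six, sternShift_thirty_six]
  ring

theorem eight_mul_fib_two_mul_le (k : ℕ) : 8 * Nat.fib (2 * k) ≤ 5 * Nat.fib (2 * k + 1) := by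
  induction k with
  | zero => norm_num
  | succ k ih =>
    rw [show 2 * (k + 1) = 2 * k + 2 by ring]
    simp only [Nat.fib_add_two]
    omega

theorem sternShift_two_mul_gapWord_four_zero (k : ℕ) :
    sternShift (2 * gapWord 4 0 k) = Nat.fib (2 * k + 1) + 4 * Nat.fib (2 * k + 2) := by
  rw [sternShift_two_mul_gapWord, appendTens_zero, show 2 * 4 = 8 by norm_num, altValue_eight]

theorem altValue_two_two_mul_appendTens_eight (k : ℕ) :
    altValue 2 (2 * appendTens 8 k) = 11 * Nat.fib (2 * k) + 11 * Nat.fib (2 * k + 1) := by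
  have h : altValue 2 (2 * appendTens 8 k) + 1 * altValue (2 * k) 8 =
      3 * altValue (2 * k + 1) 8 := altValue_two_mul_appendTens_add 2 8 k
  rw [altValue_eight, altValue_eight, Nat.fib_add_two] at h
  omega

theorem altValue_four_two_mul_appendTens_thirty_six (k : ℕ) :
    altValue 4 (2 * appendTens 36 k) = 76 * Nat.fib (2 * k) + 87 * Nat.fib (2 * k + 1) := by
  have h : altValue 4 (2 * appendTens 36 k) + 3 * altValue (2 * k) 36 =
      8 * altValue (2 * k + 1) 36 := altValue_two_mul_appendTens_add 4 36 k
  rw [altValue_thirty_six, altValue_thirty_six, Nat.fib_add_two] at h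
  omega

theorem sternShift_gapWord_thirty_six (k : ℕ) :
    sternShift (gapWord 36 k 1) = 29 * Nat.fib (2 * k) + 34 * Nat.fib (2 * k + 1) := by
  have h : altValue 2 (2 * appendTens 36 k) + 1 * altValue (2 * k) 36 =
      3 * altValue (2 * k + 1) 36 := altValue_two_mul_appendTens_add 2 36 k
  rw [altValue_thirty_six, altValue_thirty_six, Nat.fib_add_two] at h
  rw [sternShift_gapWord, mul_one]
  omega

theorem sternShift_le_fib_of_lt_two_mul_gapWord_four_zero {k v : ℕ}
    (hv : v < 2 * gapWord 4 0 (k + 1)) : sternShift v ≤ Nat.fib (2 * k + 7) := by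
  rcases lt_or_ge v (2 ^ (2 * k + 6)) with h_lt | h_ge
  · exact sternShift_le_fib h_lt
  have h_start : 8 * 4 ^ (k + 1) ≤ v / 2 := by
    rw [pow_add, pow_mul, show (2 : ℕ) ^ 2 = 4 by norm_num] at h_ge
    rw [pow_succ]
    omega
  rw [gapWord_four_zero] at hv
  obtain ⟨j, l, h_sum, h_prefix⟩ := exists_div_eq_of_lt_appendTens h_start (by omega)
  rw [Nat.div_div_eq_div_mul, ← pow_succ'] at h_prefix
  have h_le := sternShift_le_altValue h_prefix
  have h_even := altValue_even_le (x := 8) (by rw [stern_eight, sternShift_eight]; norm_num) 1 j l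
  obtain rfl : k = j + l := by omega
  rw [mul_one, altValue_two_two_mul_appendTens_eight, mul_add, mul_one, add_comm 2] at h_even
  have h_ratio := eight_mul_fib_two_mul_le (j + l)
  refine (h_le.trans h_even).trans ?_
  simp only [Nat.fib_add_two]
  omega

theorem fib_lt_sternShift_two_mul_gapWord_four_zero (k : ℕ) :
    Nat.fib (2 * k + 7) < sternShift (2 * gapWord 4 0 (k + 1)) := by
  rw [sternShift_two_mul_gapWord_four_zero, show 2 * (k + 1) = 2 * k + 2 by ring]
  have h_pos : 0 < Nat.fib (2 * k + 1) := Nat.fib_pos.2 (Nat.succ_pos _)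
  simp only [Nat.fib_add_two]
  omega

theorem isRecordSetter_two_mul_gapWord_four_zero (k : ℕ) :
    IsRecordSetter sternShift (2 * gapWord 4 0 (k + 1)) := fun _ hv =>
  (sternShift_le_fib_of_lt_two_mul_gapWord_four_zero hv).trans_lt
    (fib_lt_sternShift_two_mul_gapWord_four_zero k)

theorem two_mul_gapWord_four_zero_le_of_isRecordSetter {k v : ℕ} (hv : IsRecordSetter sternShift v)
    (hlo : 2 ^ (2 * k + 6) ≤ v) : 2 * gapWord 4 0 (k + 1) ≤ v := by
  by_contra! h_lt
  have h_le := sternShift_le_fib_of_lt_two_mul_gapWord_four_zero h_lt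
  have h_tens : appendTens 0 (k + 3) < v := by
    refine (appendTens_lt_mul_four_pow 0 (k + 3)).trans_le ?_
    rwa [zero_add, one_mul, show 4 = 2 ^ 2 by norm_num, ← pow_mul,
      show 2 * (k + 3) = 2 * k + 6 by ring]
  have h_gt := hv _ h_tens
  rw [sternShift_appendTens, altValue_zero_right, show 2 * (k + 3) + 1 = 2 * k + 7 by ring] at h_gt
  exact h_le.not_gt h_gt

theorem sternShift_two_mul_gapWord_four_zero_add_two (k : ℕ) :
    sternShift (2 * gapWord 4 0 (k + 2)) =
      23 * Nat.fib (2 * k) + 37 * Nat.fib (2 * k + 1) := by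
  rw [sternShift_two_mul_gapWord_four_zero, show 2 * (k + 2) = 2 * k + 4 by ring]
  simp only [Nat.fib_add_two]
  ring

theorem sternShift_two_mul_gapWord_four_one_add_one (k : ℕ) :
    sternShift (2 * gapWord 4 1 (k + 1)) =
      26 * Nat.fib (2 * k) + 41 * Nat.fib (2 * k + 1) := by
  rw [sternShift_two_mul_gapWord, appendTens_succ, appendTens_zero,
    show 2 * (4 * 4 + 2) = 36 by norm_num, altValue_thirty_six,
    show 2 * (k + 1) + 1 = 2 * k + 3 by ring]
  simp only [Nat.fib_add_two]
  ring

theorem sternShift_two_mul_gapWord_four_zero_lt_gapWord_thirty_six (k : ℕ) :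
    sternShift (2 * gapWord 4 0 (k + 4)) < sternShift (gapWord 36 (k + 2) 1) := by
  rw [sternShift_two_mul_gapWord_four_zero_add_two, sternShift_gapWord_thirty_six,
    show 2 * (k + 2) = 2 * k + 4 by ring]
  have h_pos : 0 < Nat.fib (2 * k + 1) := Nat.fib_pos.2 (Nat.succ_pos _)
  simp only [Nat.fib_add_two]
  omega

theorem sternShift_gapWord_thirty_six_lt_two_mul_gapWord_four_one (k : ℕ) :
    sternShift (gapWord 36 k 1) < sternShift (2 * gapWord 4 1 (k + 1)) := by
  rw [sternShift_two_mul_gapWord_four_one_add_one, sternShift_gapWord_thirty_six]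
  have h_pos : 0 < Nat.fib (2 * k + 1) := Nat.fib_pos.2 (Nat.succ_pos _)
  have h_ratio := eight_mul_fib_two_mul_le k
  omega

theorem sternShift_le_of_lt_appendTens_thirty_six {k v : ℕ} (hlo : 36 * 4 ^ k ≤ v / 8)
    (hhi : v / 8 < appendTens 36 k) : sternShift v ≤ sternShift (2 * gapWord 4 0 (k + 2)) := by
  obtain ⟨j, l, rfl, h_prefix⟩ := exists_div_eq_of_lt_appendTens hlo hhi
  rw [Nat.div_div_eq_div_mul, show 8 = 2 ^ 3 by norm_num, ← pow_add,
    show 3 + (2 * l + 1) = 2 * (2 + l) by ring] at h_prefix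
  have h_even := altValue_even_le (x := 36)
    (by rw [stern_thirty_six, sternShift_thirty_six]; norm_num) 2 j l
  rw [mul_two, altValue_four_two_mul_appendTens_thirty_six] at h_even
  refine ((sternShift_le_altValue h_prefix).trans h_even).trans ?_
  have h_ratio := eight_mul_fib_two_mul_le (j + l)
  rw [sternShift_two_mul_gapWord_four_zero_add_two, show 2 * (j + l + 1) = 2 * (j + l) + 2 by ring]
  simp only [Nat.fib_add_two]
  omega

theorem sternShift_le_of_div_two_eq_mul_appendTens_thirty_six {k v : ℕ}
    (hv : v / 2 = 4 * appendTens 36 k) :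
    sternShift v ≤ sternShift (2 * gapWord 4 0 (k + 2)) := by
  have h_le := sternShift_le_altValue (l := 1) (v := v) (x := 2 * appendTens 36 k) (by omega)
  rw [altValue_one_left, stern_two_mul, stern_two_mul, sternShift_two_mul, stern_two_mul,
    sternShift_two_mul] at h_le
  have h_sum := stern_add_sternShift_appendTens 36 k
  have h_shift := sternShift_appendTens 36 k
  rw [altValue_thirty_six] at h_sum h_shift
  have h_ratio := eight_mul_fib_two_mul_le k
  rw [sternShift_two_mul_gapWord_four_zero_add_two]
  simp only [Nat.fib_add_two] at h_sum
  omega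

theorem isRecordStep_gapWord_four_zero_gapWord_thirty_six (k : ℕ) :
    IsRecordStep sternShift (2 * gapWord 4 0 (k + 4)) (gapWord 36 (k + 2) 1) := by
  refine ⟨fun v hlo hhi => ?_, sternShift_two_mul_gapWord_four_zero_lt_gapWord_thirty_six k⟩
  have h_pow : 2 ^ (2 * (k + 4) + 1) = 32 * 4 ^ (k + 2) := by
    rw [show 2 * (k + 4) + 1 = 5 + 2 * (k + 2) by ring, pow_add, pow_mul]
    norm_num
  have h_start : 8 * 32 * 4 ^ (k + 2) ≤ v := by
    have h_gap := mul_four_pow_le_gapWord 4 0 (k + 4)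
    rw [zero_add, show 4 ^ (k + 4) = 16 * 4 ^ (k + 2) by ring] at h_gap
    omega
  have h_end : gapWord 36 (k + 2) 1 = 8 * appendTens 36 (k + 2) + 2 := by
    rw [gapWord, appendTens_succ, appendTens_zero]
    ring
  rcases lt_or_ge v (9 * 32 * 4 ^ (k + 2)) with h_lt | h_ge
  · have h_prefix : v / 2 ^ (2 * (k + 4) + 1) = 2 * 4 := by
      rw [h_pow]
      exact Nat.div_eq_of_lt_le (by omega) (by omega)
    rw [sternShift_two_mul_gapWord]
    exact sternShift_le_altValue h_prefix
  rcases lt_or_ge (v / 8) (appendTens 36 (k + 2)) with h_lt | h_ge'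
  · exact sternShift_le_of_lt_appendTens_thirty_six (by omega) h_lt
  · exact sternShift_le_of_div_two_eq_mul_appendTens_thirty_six (by omega)

theorem isRecordStep_gapWord_thirty_six_gapWord_four_one (k : ℕ) :
    IsRecordStep sternShift (gapWord 36 k 1) (2 * gapWord 4 1 (k + 1)) := by
  refine ⟨fun v hlo hhi => ?_, sternShift_gapWord_thirty_six_lt_two_mul_gapWord_four_one k⟩
  have h_start : gapWord 36 k 1 = 4 * (2 * appendTens 36 k) + 2 := rfl
  have h_end : gapWord 4 1 (k + 1) = 4 * appendTens 36 k + 2 := rfl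
  rw [sternShift_gapWord]
  exact sternShift_le_altValue (by rw [show 2 ^ (2 * 1) = 4 by norm_num]; omega)

theorem isRecordSetter_gapWord_thirty_six (k : ℕ) :
    IsRecordSetter sternShift (gapWord 36 (k + 2) 1) :=
  (isRecordStep_gapWord_four_zero_gapWord_thirty_six k).isRecordSetter
    (isRecordSetter_two_mul_gapWord_four_zero (k + 3))

theorem isRecordStep_gapWord_four_of_lt (k : ℕ) :
    ∀ i < k / 2, IsRecordStep sternShift (2 * gapWord 4 (i + 1) (k - i))
      (2 * gapWord 4 (i + 1 + 1) (k - (i + 1))) := by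
  intro i hi
  rw [show k - i = k - (i + 1) + 1 by omega]
  exact isRecordStep_gapWord_four (by omega)

theorem isRecordStep_gapWord_zero_of_lt (k : ℕ) :
    ∀ i < k, IsRecordStep sternShift (gapWord 0 (i + 1) (k - i))
      (gapWord 0 (i + 1 + 1) (k - (i + 1))) := by
  intro i hi
  rw [show k - i = k - (i + 1) + 1 by omega]
  exact isRecordStep_gapWord_zero i _

theorem isRecordStep_gapWord_four_half (k : ℕ) :
    IsRecordStep sternShift (2 * gapWord 4 (k / 2 + 1) (k - k / 2)) (gapWord 0 1 (k + 2)) := by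
  have h_step := isRecordStep_gapWord_four_gapWord_zero (i := k / 2 + 1) (k := k - k / 2)
    (by omega) (by omega)
  rwa [show k / 2 + 1 + (k - k / 2) + 1 = k + 2 by omega] at h_step

theorem isRecordSetter_two_mul_gapWord_four {i k : ℕ} (hi : i ≤ (k + 3) / 2) :
    IsRecordSetter sternShift (2 * gapWord 4 (i + 1) (k + 3 - i)) :=
  isRecordSetter_of_forall_isRecordStep (r := fun i => 2 * gapWord 4 (i + 1) (k + 3 - i))
    (isRecordStep_gapWord_four_of_lt (k + 3))
    ((isRecordStep_gapWord_thirty_six_gapWord_four_one (k + 2)).isRecordSetter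
      (isRecordSetter_gapWord_thirty_six k)) i hi

theorem isRecordSetter_gapWord_zero {i k : ℕ} (hi : i ≤ k + 5) :
    IsRecordSetter sternShift (gapWord 0 (i + 1) (k + 5 - i)) :=
  isRecordSetter_of_forall_isRecordStep (r := fun i => gapWord 0 (i + 1) (k + 5 - i))
    (isRecordStep_gapWord_zero_of_lt (k + 5))
    ((isRecordStep_gapWord_four_half (k + 3)).isRecordSetter
      (isRecordSetter_two_mul_gapWord_four le_rfl)) i hi

theorem eq_gapWord_zero_zero_of_isRecordSetter {n v : ℕ} (hv : IsRecordSetter sternShift v)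
    (hlo : gapWord 0 (n + 1) 0 ≤ v) (hhi : v < 2 ^ (2 * n + 3)) : v = gapWord 0 (n + 1) 0 := by
  by_contra h_ne
  have h_gt := hv _ (lt_of_le_of_ne' hlo h_ne)
  rw [sternShift_gapWord_zero_zero, show 2 * (n + 1) + 2 = 2 * n + 3 + 1 by ring] at h_gt
  exact h_gt.not_ge (sternShift_le_fib hhi)

theorem IsRecordSetter.eq_gapWord {k v : ℕ} (hv : IsRecordSetter sternShift v)
    (hlo : 2 ^ (2 * k + 12) ≤ v) (hhi : v < 2 ^ (2 * k + 13)) :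
    v = 2 * gapWord 4 0 (k + 4) ∨ v = gapWord 36 (k + 2) 1 ∨
      (∃ i ≤ (k + 3) / 2, v = 2 * gapWord 4 (i + 1) (k + 3 - i)) ∨
      ∃ i ≤ k + 5, v = gapWord 0 (i + 1) (k + 5 - i) := by
  have h_four_zero := two_mul_gapWord_four_zero_le_of_isRecordSetter (k := k + 3) hv hlo
  rcases (isRecordStep_gapWord_four_zero_gapWord_thirty_six k).eq_or_le hv h_four_zero with
    h_eq | h_thirty_six
  · exact Or.inl h_eq
  rcases (isRecordStep_gapWord_thirty_six_gapWord_four_one (k + 2)).eq_or_le hv h_thirty_six with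
    h_eq | h_four_one
  · exact Or.inr (Or.inl h_eq)
  rcases hv.exists_eq_or_le (isRecordStep_gapWord_four_of_lt (k + 3)) h_four_one with
    ⟨i, hi, h_eq⟩ | h_four_half
  · exact Or.inr (Or.inr (Or.inl ⟨i, hi.le, h_eq⟩))
  rcases (isRecordStep_gapWord_four_half (k + 3)).eq_or_le hv h_four_half with h_eq | h_zero_one
  · exact Or.inr (Or.inr (Or.inl ⟨_, le_rfl, h_eq⟩))
  rcases hv.exists_eq_or_le (isRecordStep_gapWord_zero_of_lt (k + 5)) h_zero_one with
    ⟨i, hi, h_eq⟩ | h_zero_last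
  · exact Or.inr (Or.inr (Or.inr ⟨i, hi.le, h_eq⟩))
  · rw [Nat.sub_self] at h_zero_last
    refine Or.inr (Or.inr (Or.inr ⟨k + 5, le_rfl, ?_⟩))
    rw [Nat.sub_self]
    exact eq_gapWord_zero_zero_of_isRecordSetter hv h_zero_last hhi

theorem binaryString_two_mul {x : ℕ} (hx : x ≠ 0) :
    binaryString (2 * x) = binaryString x ++ [0] := by
  rw [binaryString, Nat.digits_base_mul one_lt_two (Nat.pos_of_ne_zero hx), List.reverse_cons,
    binaryString]

theorem binaryString_two_mul_add_one (x : ℕ) :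
    binaryString (2 * x + 1) = binaryString x ++ [1] := by
  rw [binaryString, add_comm, Nat.digits_add 2 one_lt_two 1 x one_lt_two (Or.inl one_ne_zero),
    List.reverse_cons, binaryString]

theorem strPow_succ (x : List ℕ) (i : ℕ) : strPow x (i + 1) = strPow x i ++ x := by
  simp [strPow, List.replicate_succ']

theorem length_strPow (x : List ℕ) (i : ℕ) : (strPow x i).length = i * x.length := by
  simp [strPow]

theorem binaryString_appendTens (x j : ℕ) :
    binaryString (appendTens x j) = binaryString x ++ strPow [1, 0] j := by
  induction j with
  | zero => simp [appendTens, strPow]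
  | succ j ih =>
    rw [appendTens_succ, show 4 * appendTens x j + 2 = 2 * (2 * appendTens x j + 1) by ring,
      binaryString_two_mul (Nat.succ_ne_zero _), binaryString_two_mul_add_one, ih, strPow_succ]
    simp

theorem binaryString_gapWord {x i : ℕ} (h : appendTens x i ≠ 0) (k : ℕ) :
    binaryString (gapWord x i k) =
      binaryString x ++ strPow [1, 0] i ++ [0] ++ strPow [1, 0] k := by
  rw [gapWord, binaryString_appendTens, binaryString_two_mul h, binaryString_appendTens]

theorem binaryString_two_mul_gapWord_four (i k : ℕ) :
    binaryString (2 * gapWord 4 i k) =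
      [1, 0, 0] ++ strPow [1, 0] i ++ [0] ++ strPow [1, 0] k ++ [0] := by
  have h_tens := appendTens_ne_zero (x := 4) (by norm_num) i
  have h_gap : gapWord 4 i k ≠ 0 := appendTens_ne_zero (by omega) k
  rw [binaryString_two_mul h_gap, binaryString_gapWord h_tens]
  simp [binaryString]

theorem binaryString_gapWord_thirty_six (i k : ℕ) :
    binaryString (gapWord 36 i k) =
      [1, 0, 0, 1, 0, 0] ++ strPow [1, 0] i ++ [0] ++ strPow [1, 0] k := by
  rw [binaryString_gapWord (appendTens_ne_zero (by norm_num) i)]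
  simp [binaryString]

theorem binaryString_gapWord_zero (i k : ℕ) :
    binaryString (gapWord 0 (i + 1) k) =
      strPow [1, 0] (i + 1) ++ [0] ++ strPow [1, 0] k := by
  have h_tens : appendTens 0 (i + 1) ≠ 0 := Nat.succ_ne_zero _
  rw [binaryString_gapWord h_tens]
  simp [binaryString]

theorem length_binaryString_eq_succ_iff (v l : ℕ) :
    (binaryString v).length = l + 1 ↔ 2 ^ l ≤ v ∧ v < 2 ^ (l + 1) := by
  rw [binaryString, List.length_reverse, ← Nat.lt_digits_length_iff one_lt_two,
    ← Nat.digits_length_le_iff one_lt_two]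
  omega

theorem isRecordSetter_and_length_binaryString_iff (k v : ℕ) :
    IsRecordSetter sternShift v ∧ (binaryString v).length = 2 * k + 13 ↔
      v = 2 * gapWord 4 0 (k + 4) ∨ v = gapWord 36 (k + 2) 1 ∨
        (∃ i ≤ (k + 3) / 2, v = 2 * gapWord 4 (i + 1) (k + 3 - i)) ∨
        ∃ i ≤ k + 5, v = gapWord 0 (i + 1) (k + 5 - i) := by
  constructor
  · rintro ⟨hv, h_length⟩
    obtain ⟨hlo, hhi⟩ := (length_binaryString_eq_succ_iff v (2 * k + 12)).1 h_length
    exact hv.eq_gapWord hlo hhi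
  · rintro (rfl | rfl | ⟨i, hi, rfl⟩ | ⟨i, hi, rfl⟩)
    · refine ⟨isRecordSetter_two_mul_gapWord_four_zero (k + 3), ?_⟩
      rw [binaryString_two_mul_gapWord_four]
      simp only [List.length_append, List.length_cons, List.length_nil, length_strPow]
      omega
    · refine ⟨isRecordSetter_gapWord_thirty_six k, ?_⟩
      rw [binaryString_gapWord_thirty_six]
      simp only [List.length_append, List.length_cons, List.length_nil, length_strPow]
      omega
    · refine ⟨isRecordSetter_two_mul_gapWord_four hi, ?_⟩
      rw [binaryString_two_mul_gapWord_four]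
      simp only [List.length_append, List.length_cons, List.length_nil, length_strPow]
      omega
    · refine ⟨isRecordSetter_gapWord_zero hi, ?_⟩
      rw [binaryString_gapWord_zero]
      simp only [List.length_append, List.length_cons, List.length_nil, length_strPow]
      omega

theorem ceil_sub_one_div_two (n : ℕ) : ⌈((n : ℚ) - 1) / 2⌉ = ((n / 2 : ℕ) : ℤ) := by
  rw [Int.ceil_eq_iff]
  rcases Nat.even_or_odd' n with ⟨k, rfl | rfl⟩
  · rw [show 2 * k / 2 = k by omega]
    push_cast
    constructor <;> linarith
  · rw [show (2 * k + 1) / 2 = k by omega]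
    push_cast
    constructor <;> linarith

theorem exists_isRecordSetter_and_binaryString_eq_iff (k : ℕ) (w : List ℕ) :
    (∃ v, IsRecordSetter sternShift v ∧ binaryString v = w ∧ w.length = 2 * k + 13) ↔
      w = binaryString (2 * gapWord 4 0 (k + 4)) ∨ w = binaryString (gapWord 36 (k + 2) 1) ∨
        (∃ i ≤ (k + 3) / 2, w = binaryString (2 * gapWord 4 (i + 1) (k + 3 - i))) ∨
        ∃ i ≤ k + 5, w = binaryString (gapWord 0 (i + 1) (k + 5 - i)) := by
  have h_iff := isRecordSetter_and_length_binaryString_iff k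
  grind

theorem mainTheorem3 (n : ℕ) (hn : 5 ≤ n) (w : List ℕ) :
    (∃ v : ℕ, IsRecordSetter sternShift v ∧ binaryString v = w ∧ w.length = 2 * n + 3) ↔
      w = [1, 0, 0, 0] ++ strPow [1, 0] (n - 1) ++ [0] ∨
      w = [1, 0, 0, 1, 0, 0] ++ strPow [1, 0] (n - 3) ++ [0] ++ [1, 0] ∨
      w = [1, 0, 0, 1, 0, 0] ++ strPow [1, 0] (n - 2) ++ [0] ∨
      (∃ i : ℕ, 1 < i ∧ (i : ℤ) ≤ ⌈((n : ℚ) - 1) / 2⌉ ∧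
        w = [1, 0, 0] ++ strPow [1, 0] i ++ [0] ++ strPow [1, 0] (n - i - 1) ++ [0]) ∨
      (∃ i : ℕ, i ≤ n ∧
        w = strPow [1, 0] (i + 1) ++ [0] ++ strPow [1, 0] (n - i)) := by
  obtain ⟨k, rfl⟩ := Nat.exists_eq_add_of_le' hn
  rw [ceil_sub_one_div_two, show 2 * (k + 5) + 3 = 2 * k + 13 by ring,
    exists_isRecordSetter_and_binaryString_eq_iff]
  simp only [binaryString_two_mul_gapWord_four, binaryString_gapWord_thirty_six,
    binaryString_gapWord_zero]
  refine or_congr Iff.rfl (or_congr Iff.rfl ?_)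
  rw [← or_assoc]
  refine or_congr_left ?_
  constructor
  · rintro ⟨_ | i, hi, rfl⟩
    · exact Or.inl rfl
    · exact Or.inr ⟨i + 2, by omega, by omega, by
        rw [show k + 5 - (i + 2) - 1 = k + 3 - (i + 1) by omega]⟩
  · rintro (rfl | ⟨i, h_one_lt, h_le, rfl⟩)
    · exact ⟨0, Nat.zero_le _, rfl⟩
    · obtain ⟨i, rfl⟩ := Nat.exists_eq_add_of_lt h_one_lt
      exact ⟨1 + i, by omega, by
        rw [show k + 5 - (1 + i + 1) - 1 = k + 3 - (1 + i) by omega]⟩
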